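/- A birestriction monoid is an algebra $(S;\cdot,{}^*,{}^+,1)$ such that $(S;\cdot,1)$ is a monoid and the identities $xx^*=x$, $x^*y^*=y^*x^*$, $(xy^*)^*=x^*y^*$, $x^*y=y(xy)^*$, $x^+x=x$, $x^+y^+=y^+x^+$, $(x^+y)^+=x^+y^+$, $xy^+=(xy)^+x$, $(x^+)^*=x^+$, $(x^*)^+=x^*$ hold. Its set of projections $P(S)=\{s^*: s\in S\}=\{s^+: s\in S\}$ is a semilattice under $e\wedge f=ef$. Every inverse monoid is a birestriction monoid with $x^*=x^{-1}x$ and $x^+=xx^{-1}$, and its projections are its idempotents. Let $X$ be a set, let $\mathsf{FBR}(X)$ and $\mathsf{FI}(X)$ be the free birestriction monoid and the free inverse monoid on $X$, let $R$ be a set of relations $u=v$ with $u,v\in\mathsf{FBR}(X)$, and let $S=\mathrm{BRestr}\langle X\mid R\rangle$ be the quotient of $\mathsf{FBR}(X)$ by the congruence generated by $R$. Let $\psi\colon\mathsf{FBR}(X)\to\mathsf{FI}(X)$ be the morphism of birestriction monoids which is the identity on $X$, let $\tilde S=\mathrm{Inv}\langle X\mid\psi(R)\rangle$ be the quotient of $\mathsf{FI}(X)$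 by the congruence generated by the relations $\psi(u)=\psi(v)$, where $u=v$ is in $R$, and let $\psi\colon S\to\tilde S$ be the induced morphism. For words $w$ in the free monoid $(X\cup X^{-1})^*$ define $D_w\in P(\mathsf{FBR}(X))$ recursively by $$D_1=1,\qquad D_{wx}=(D_wx)^*,\qquad D_{wx^{-1}}=(xD_w)^+\qquad (x\in X).$$ Then the image of $D_w$ in $S$ is a projection which depends only on the value of $w$ in $\tilde S$, so that there is a well-defined map $D\colon\tilde S\to P(S)$ sending the value of $w$ in $\tilde S$ to the image of $D_w$ in $S$. Moreover, $\psi$ restricts to a well-defined map $\psi\colon P(S)\to E(\tilde S)$ into the semilattice $E(\tilde S)$ of idempotents of $\tilde S$, $D$ restricts to a map $D\colon E(\tilde S)\to P(S)$, and these two restrictions are mutually inverse isomorphisms of semilattices. -/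

import Mathlib

universe u v w

/-! ### Birestriction monoids -/

/-- A birestriction monoid: an algebra `(S; ·, *, +, 1)` of type `(2,1,1,0)`.
`rstar x` is `x^*` and `rplus x` is `x^+`. -/
class BirestrictionMonoid (S : Type u) extends Monoid S where
  rstar : S → S
  rplus : S → S
  mul_rstar_self : ∀ x : S, x * rstar x = x
  rstar_comm : ∀ x y : S, rstar x * rstar y = rstar y * rstar x
  rstar_mul_rstar : ∀ x y : S, rstar (x * rstar y) = rstar x * rstar y
  rstar_mul : ∀ x y : S, rstar x * y = y * rstar (x * y)
  rplus_mul_self : ∀ x : S, rplus x * x = x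
  rplus_comm : ∀ x y : S, rplus x * rplus y = rplus y * rplus x
  rplus_rplus_mul : ∀ x y : S, rplus (rplus x * y) = rplus x * rplus y
  mul_rplus : ∀ x y : S, x * rplus y = rplus (x * y) * x
  rstar_rplus : ∀ x : S, rstar (rplus x) = rplus x
  rplus_rstar : ∀ x : S, rplus (rstar x) = rstar x

namespace BirestrictionMonoid

variable {S : Type u} [BirestrictionMonoid S]

/-- `x` is a projection if it has the form `s^*` (equivalently, the form `s^+`). -/
def IsProjection (x : S) : Prop := ∃ s : S, rstar s = x

theorem isProjection_rstar (s : S) : IsProjection (rstar s) := ⟨s, rfl⟩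

theorem isProjection_rplus (s : S) : IsProjection (rplus s) := ⟨rplus s, rstar_rplus s⟩

theorem isProjection_one : IsProjection (1 : S) :=
  ⟨1, by simpa using mul_rstar_self (1 : S)⟩

theorem IsProjection.mul {e f : S} (he : IsProjection e) (hf : IsProjection f) :
    IsProjection (e * f) := by
  obtain ⟨x, rfl⟩ := he
  obtain ⟨y, rfl⟩ := hf
  exact ⟨x * rstar y, rstar_mul_rstar x y⟩

theorem IsProjection.mul_comm {e f : S} (he : IsProjection e) (hf : IsProjection f) :
    e * f = f * e := by
  obtain ⟨x, rfl⟩ := he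
  obtain ⟨y, rfl⟩ := hf
  exact rstar_comm x y

theorem IsProjection.mul_self {e : S} (he : IsProjection e) : e * e = e := by
  obtain ⟨x, rfl⟩ := he
  rw [← rstar_mul_rstar, mul_rstar_self]

end BirestrictionMonoid

open BirestrictionMonoid in
/-- The set `P(S)` of projections of a birestriction monoid. -/
def Proj (S : Type u) [BirestrictionMonoid S] : Type u := {e : S // IsProjection e}

/-- `P(S)` is a semilattice with `e ∧ f = ef`. -/
instance Proj.instSemilatticeInf (S : Type u) [BirestrictionMonoid S] :
    SemilatticeInf (Proj S) :=
  letI : Min (Proj S) := ⟨fun e f => ⟨e.1 * f.1, e.2.mul f.2⟩⟩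
  SemilatticeInf.mk' (fun e f => Subtype.ext (e.2.mul_comm f.2))
    (fun e f g => Subtype.ext (mul_assoc e.1 f.1 g.1))
    (fun e => Subtype.ext e.2.mul_self)

/-- Morphisms of birestriction monoids, i.e. `(2,1,1,0)`-morphisms. -/
structure BRHom (S : Type u) (T : Type v) [BirestrictionMonoid S] [BirestrictionMonoid T] where
  toFun : S → T
  map_one : toFun 1 = 1
  map_mul : ∀ x y : S, toFun (x * y) = toFun x * toFun y
  map_rstar : ∀ x : S,
    toFun (BirestrictionMonoid.rstar x) = BirestrictionMonoid.rstar (toFun x)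
  map_rplus : ∀ x : S,
    toFun (BirestrictionMonoid.rplus x) = BirestrictionMonoid.rplus (toFun x)

/-! ### The free birestriction monoid -/

/-- Terms in the signature `(·, *, +, 1)` over `X`. -/
inductive BRTerm (X : Type u) : Type u
  | var : X → BRTerm X
  | one : BRTerm X
  | mul : BRTerm X → BRTerm X → BRTerm X
  | star : BRTerm X → BRTerm X
  | plus : BRTerm X → BRTerm X

/-- The least congruence on the term algebra which contains all instances of the
defining identities of birestriction monoids. -/
inductive BRTerm.Equ {X : Type u} : BRTerm X → BRTerm X → Prop
  | refl (s) : Equ s s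
  | symm {s t} : Equ s t → Equ t s
  | trans {s t r} : Equ s t → Equ t r → Equ s r
  | mul_congr {s s' t t'} : Equ s s' → Equ t t' → Equ (.mul s t) (.mul s' t')
  | star_congr {s s'} : Equ s s' → Equ (.star s) (.star s')
  | plus_congr {s s'} : Equ s s' → Equ (.plus s) (.plus s')
  | assoc (x y z) : Equ (.mul (.mul x y) z) (.mul x (.mul y z))
  | one_mul (x) : Equ (.mul .one x) x
  | mul_one (x) : Equ (.mul x .one) x
  | mul_star_self (x) : Equ (.mul x (.star x)) x
  | star_comm (x y) : Equ (.mul (.star x) (.star y)) (.mul (.star y) (.star x))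
  | star_mul_star (x y) : Equ (.star (.mul x (.star y))) (.mul (.star x) (.star y))
  | star_mul (x y) : Equ (.mul (.star x) y) (.mul y (.star (.mul x y)))
  | plus_mul_self (x) : Equ (.mul (.plus x) x) x
  | plus_comm (x y) : Equ (.mul (.plus x) (.plus y)) (.mul (.plus y) (.plus x))
  | plus_plus_mul (x y) : Equ (.plus (.mul (.plus x) y)) (.mul (.plus x) (.plus y))
  | mul_plus (x y) : Equ (.mul x (.plus y)) (.mul (.plus (.mul x y)) x)
  | star_plus (x) : Equ (.star (.plus x)) (.plus x)
  | plus_star (x) : Equ (.plus (.star x)) (.star x)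

instance BRTerm.instSetoid (X : Type u) : Setoid (BRTerm X) where
  r := BRTerm.Equ
  iseqv := ⟨.refl, .symm, .trans⟩

/-- The free birestriction monoid `FBR(X)`. -/
def FBR (X : Type u) : Type u := Quotient (BRTerm.instSetoid X)

instance FBR.instBirestrictionMonoid (X : Type u) : BirestrictionMonoid (FBR X) where
  mul := Quotient.map₂ .mul fun _ _ h _ _ h' => .mul_congr h h'
  one := Quotient.mk _ .one
  rstar := Quotient.map .star fun _ _ h => .star_congr h
  rplus := Quotient.map .plus fun _ _ h => .plus_congr h
  mul_assoc := by rintro ⟨x⟩ ⟨y⟩ ⟨z⟩; exact Quotient.sound (.assoc x y z)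
  one_mul := by rintro ⟨x⟩; exact Quotient.sound (.one_mul x)
  mul_one := by rintro ⟨x⟩; exact Quotient.sound (.mul_one x)
  mul_rstar_self := by rintro ⟨x⟩; exact Quotient.sound (.mul_star_self x)
  rstar_comm := by rintro ⟨x⟩ ⟨y⟩; exact Quotient.sound (.star_comm x y)
  rstar_mul_rstar := by rintro ⟨x⟩ ⟨y⟩; exact Quotient.sound (.star_mul_star x y)
  rstar_mul := by rintro ⟨x⟩ ⟨y⟩; exact Quotient.sound (.star_mul x y)
  rplus_mul_self := by rintro ⟨x⟩; exact Quotient.sound (.plus_mul_self x)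
  rplus_comm := by rintro ⟨x⟩ ⟨y⟩; exact Quotient.sound (.plus_comm x y)
  rplus_rplus_mul := by rintro ⟨x⟩ ⟨y⟩; exact Quotient.sound (.plus_plus_mul x y)
  mul_rplus := by rintro ⟨x⟩ ⟨y⟩; exact Quotient.sound (.mul_plus x y)
  rstar_rplus := by rintro ⟨x⟩; exact Quotient.sound (.star_plus x)
  rplus_rstar := by rintro ⟨x⟩; exact Quotient.sound (.plus_star x)

/-- The assignment map `X → FBR(X)`. -/
def FBR.of {X : Type u} (x : X) : FBR X := Quotient.mk _ (.var x)

/-- The value of a term in a birestriction monoid under an assignment of the variables. -/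
def BRTerm.eval {X : Type u} {S : Type v} [BirestrictionMonoid S] (f : X → S) : BRTerm X → S
  | .var x => f x
  | .one => 1
  | .mul s t => s.eval f * t.eval f
  | .star s => BirestrictionMonoid.rstar (s.eval f)
  | .plus s => BirestrictionMonoid.rplus (s.eval f)

theorem BRTerm.Equ.eval_eq {X : Type u} {S : Type v} [BirestrictionMonoid S] (f : X → S)
    {s t : BRTerm X} (h : BRTerm.Equ s t) : s.eval f = t.eval f := by
  induction h with
  | refl => rfl
  | symm _ ih => exact ih.symm
  | trans _ _ ih ih' => exact ih.trans ih'
  | mul_congr _ _ ih ih' => simp only [BRTerm.eval, ih, ih']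
  | star_congr _ ih => simp only [BRTerm.eval, ih]
  | plus_congr _ ih => simp only [BRTerm.eval, ih]
  | assoc => exact mul_assoc _ _ _
  | one_mul => exact _root_.one_mul _
  | mul_one => exact _root_.mul_one _
  | mul_star_self => exact BirestrictionMonoid.mul_rstar_self _
  | star_comm => exact BirestrictionMonoid.rstar_comm _ _
  | star_mul_star => exact BirestrictionMonoid.rstar_mul_rstar _ _
  | star_mul => exact BirestrictionMonoid.rstar_mul _ _
  | plus_mul_self => exact BirestrictionMonoid.rplus_mul_self _
  | plus_comm => exact BirestrictionMonoid.rplus_comm _ _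
  | plus_plus_mul => exact BirestrictionMonoid.rplus_rplus_mul _ _
  | mul_plus => exact BirestrictionMonoid.mul_rplus _ _
  | star_plus => exact BirestrictionMonoid.rstar_rplus _
  | plus_star => exact BirestrictionMonoid.rplus_rstar _

/-- The canonical morphism from `FBR(X)` to a birestriction monoid extending `f`. -/
def FBR.lift {X : Type u} {S : Type v} [BirestrictionMonoid S] (f : X → S) : BRHom (FBR X) S where
  toFun := Quotient.lift (BRTerm.eval f) fun _ _ h => BRTerm.Equ.eval_eq f h
  map_one := rfl
  map_mul := by rintro ⟨x⟩ ⟨y⟩; rfl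
  map_rstar := by rintro ⟨x⟩; rfl
  map_rplus := by rintro ⟨x⟩; rfl

/-! ### Presentations of birestriction monoids -/

/-- The `(2,1,1,0)`-congruence on a birestriction monoid generated by a relation. -/
inductive BRCongr {S : Type u} [BirestrictionMonoid S] (R : S → S → Prop) : S → S → Prop
  | of {a b} : R a b → BRCongr R a b
  | refl (a) : BRCongr R a a
  | symm {a b} : BRCongr R a b → BRCongr R b a
  | trans {a b c} : BRCongr R a b → BRCongr R b c → BRCongr R a c
  | mul {a b c d} : BRCongr R a b → BRCongr R c d → BRCongr R (a * c) (b * d)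
  | rstar {a b} : BRCongr R a b →
      BRCongr R (BirestrictionMonoid.rstar a) (BirestrictionMonoid.rstar b)
  | rplus {a b} : BRCongr R a b →
      BRCongr R (BirestrictionMonoid.rplus a) (BirestrictionMonoid.rplus b)

def BRCongr.setoid {S : Type u} [BirestrictionMonoid S] (R : S → S → Prop) : Setoid S where
  r := BRCongr R
  iseqv := ⟨.refl, .symm, .trans⟩

/-- `BRestr⟨X | R⟩`: the quotient of `FBR(X)` by the congruence generated by the pairs `(u, v)`
such that `u = v` is a relation in `R`. -/
def BRestr {X : Type u} (R : FBR X → FBR X → Prop) : Type u := Quotient (BRCongr.setoid R)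

instance BRestr.instBirestrictionMonoid {X : Type u} (R : FBR X → FBR X → Prop) :
    BirestrictionMonoid (BRestr R) where
  mul := Quotient.map₂ (· * ·) fun _ _ h _ _ h' => BRCongr.mul h h'
  one := Quotient.mk _ 1
  rstar := Quotient.map BirestrictionMonoid.rstar fun _ _ h => BRCongr.rstar h
  rplus := Quotient.map BirestrictionMonoid.rplus fun _ _ h => BRCongr.rplus h
  mul_assoc := by rintro ⟨x⟩ ⟨y⟩ ⟨z⟩; exact congrArg _ (mul_assoc x y z)
  one_mul := by rintro ⟨x⟩; exact congrArg _ (one_mul x)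
  mul_one := by rintro ⟨x⟩; exact congrArg _ (mul_one x)
  mul_rstar_self := by
    rintro ⟨x⟩; exact congrArg _ (BirestrictionMonoid.mul_rstar_self x)
  rstar_comm := by
    rintro ⟨x⟩ ⟨y⟩; exact congrArg _ (BirestrictionMonoid.rstar_comm x y)
  rstar_mul_rstar := by
    rintro ⟨x⟩ ⟨y⟩; exact congrArg _ (BirestrictionMonoid.rstar_mul_rstar x y)
  rstar_mul := by
    rintro ⟨x⟩ ⟨y⟩; exact congrArg _ (BirestrictionMonoid.rstar_mul x y)
  rplus_mul_self := by
    rintro ⟨x⟩; exact congrArg _ (BirestrictionMonoid.rplus_mul_self x)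
  rplus_comm := by
    rintro ⟨x⟩ ⟨y⟩; exact congrArg _ (BirestrictionMonoid.rplus_comm x y)
  rplus_rplus_mul := by
    rintro ⟨x⟩ ⟨y⟩; exact congrArg _ (BirestrictionMonoid.rplus_rplus_mul x y)
  mul_rplus := by
    rintro ⟨x⟩ ⟨y⟩; exact congrArg _ (BirestrictionMonoid.mul_rplus x y)
  rstar_rplus := by
    rintro ⟨x⟩; exact congrArg _ (BirestrictionMonoid.rstar_rplus x)
  rplus_rstar := by
    rintro ⟨x⟩; exact congrArg _ (BirestrictionMonoid.rplus_rstar x)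

/-- The canonical quotient morphism `FBR(X) → BRestr⟨X | R⟩`. -/
def BRestr.mk {X : Type u} (R : FBR X → FBR X → Prop) : BRHom (FBR X) (BRestr R) where
  toFun := Quotient.mk _
  map_one := rfl
  map_mul _ _ := rfl
  map_rstar _ := rfl
  map_rplus _ := rfl

/-! ### Inverse monoids -/

/-- Inverse monoids, by the usual equational axioms in the signature `(·, ⁻¹, 1)`. These are
equivalent to the existence of exactly one `y` with `x y x = x` and `y x y = y` for each `x`. -/
class InverseMonoid (M : Type u) extends Monoid M, Inv M where
  inv_inv' : ∀ x : M, x⁻¹⁻¹ = x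
  mul_inv_rev' : ∀ x y : M, (x * y)⁻¹ = y⁻¹ * x⁻¹
  mul_inv_mul_self : ∀ x : M, x * x⁻¹ * x = x
  mul_inv_comm : ∀ x y : M, x * x⁻¹ * (y * y⁻¹) = y * y⁻¹ * (x * x⁻¹)

namespace InverseMonoid

variable {M : Type u} [InverseMonoid M]

theorem inv_mul_mul_inv (x : M) : x⁻¹ * x * x⁻¹ = x⁻¹ := by
  simpa [inv_inv'] using mul_inv_mul_self x⁻¹

theorem inv_mul_comm (x y : M) : x⁻¹ * x * (y⁻¹ * y) = y⁻¹ * y * (x⁻¹ * x) := by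
  simpa [inv_inv'] using mul_inv_comm x⁻¹ y⁻¹

theorem mul_inv_comm_inv_mul (x y : M) : x * x⁻¹ * (y⁻¹ * y) = y⁻¹ * y * (x * x⁻¹) := by
  simpa [inv_inv'] using mul_inv_comm x y⁻¹

theorem inv_eq_of_idem {e : M} (he : e * e = e) : e⁻¹ = e := by
  have he' : e⁻¹ * e⁻¹ = e⁻¹ := by rw [← mul_inv_rev', he]
  calc e⁻¹ = e⁻¹ * (e * e) * e⁻¹ := by rw [he, inv_mul_mul_inv]
    _ = e⁻¹ * e * (e * e⁻¹) := by simp only [mul_assoc]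
    _ = e * e⁻¹ * (e⁻¹ * e) := (mul_inv_comm_inv_mul e e).symm
    _ = e * (e⁻¹ * e⁻¹) * e := by simp only [mul_assoc]
    _ = e := by rw [he', mul_inv_mul_self]

theorem idem_comm {e f : M} (he : e * e = e) (hf : f * f = f) : e * f = f * e := by
  have h := mul_inv_comm e f
  rwa [inv_eq_of_idem he, inv_eq_of_idem hf, he, hf] at h

theorem idem_mul {e f : M} (he : e * e = e) (hf : f * f = f) : e * f * (e * f) = e * f := by
  calc e * f * (e * f) = e * (f * e) * f := by simp only [mul_assoc]
    _ = e * (e * f) * f := by rw [idem_comm hf he]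
    _ = (e * e) * (f * f) := by simp only [mul_assoc]
    _ = e * f := by rw [he, hf]

theorem idem_inv_mul (x : M) : x⁻¹ * x * (x⁻¹ * x) = x⁻¹ * x := by
  rw [← mul_assoc, inv_mul_mul_inv]

theorem idem_mul_inv (x : M) : x * x⁻¹ * (x * x⁻¹) = x * x⁻¹ := by
  rw [← mul_assoc, mul_inv_mul_self]

/-- An inverse monoid is a birestriction monoid with `x^* = x⁻¹ x` and `x^+ = x x⁻¹`. -/
instance toBirestrictionMonoid : BirestrictionMonoid M where
  rstar x := x⁻¹ * x
  rplus x := x * x⁻¹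
  mul_rstar_self x := by rw [← mul_assoc, mul_inv_mul_self]
  rstar_comm := inv_mul_comm
  rstar_mul_rstar x y := by
    rw [mul_inv_rev', inv_eq_of_idem (idem_inv_mul y)]
    calc y⁻¹ * y * x⁻¹ * (x * (y⁻¹ * y)) = y⁻¹ * y * (x⁻¹ * x) * (y⁻¹ * y) := by
          simp only [mul_assoc]
      _ = x⁻¹ * x * (y⁻¹ * y * (y⁻¹ * y)) := by rw [inv_mul_comm y x, mul_assoc]
      _ = _ := by rw [idem_inv_mul]
  rstar_mul x y := by
    rw [mul_inv_rev']
    calc x⁻¹ * x * y = x⁻¹ * x * (y * y⁻¹) * y := by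
          rw [mul_assoc _ (y * y⁻¹), mul_inv_mul_self]
      _ = y * y⁻¹ * (x⁻¹ * x) * y := by rw [mul_inv_comm_inv_mul]
      _ = _ := by simp only [mul_assoc]
  rplus_mul_self := mul_inv_mul_self
  rplus_comm := mul_inv_comm
  rplus_rplus_mul x y := by
    rw [mul_inv_rev', inv_eq_of_idem (idem_mul_inv x)]
    calc x * x⁻¹ * y * (y⁻¹ * (x * x⁻¹)) = x * x⁻¹ * (y * y⁻¹ * (x * x⁻¹)) := by
          simp only [mul_assoc]
      _ = x * x⁻¹ * (x * x⁻¹) * (y * y⁻¹) := by rw [mul_inv_comm y x, ← mul_assoc]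
      _ = _ := by rw [idem_mul_inv]
  mul_rplus x y := by
    rw [mul_inv_rev']
    calc x * (y * y⁻¹) = x * (x⁻¹ * x * (y * y⁻¹)) := by
          rw [← mul_assoc x (x⁻¹ * x), ← mul_assoc x x⁻¹, mul_inv_mul_self]
      _ = x * (y * y⁻¹ * (x⁻¹ * x)) := by rw [mul_inv_comm_inv_mul]
      _ = _ := by simp only [mul_assoc]
  rstar_rplus x := by rw [inv_eq_of_idem (idem_mul_inv x), idem_mul_inv]
  rplus_rstar x := by rw [inv_eq_of_idem (idem_inv_mul x), idem_inv_mul]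

end InverseMonoid

/-- The set `E(M)` of idempotents of an inverse monoid. -/
def Idem (M : Type u) [InverseMonoid M] : Type u := {e : M // e * e = e}

/-- `E(M)` is a semilattice with `e ∧ f = ef`. -/
instance Idem.instSemilatticeInf (M : Type u) [InverseMonoid M] :
    SemilatticeInf (Idem M) :=
  letI : Min (Idem M) := ⟨fun e f => ⟨e.1 * f.1, InverseMonoid.idem_mul e.2 f.2⟩⟩
  SemilatticeInf.mk' (fun e f => Subtype.ext (InverseMonoid.idem_comm e.2 f.2))
    (fun e f g => Subtype.ext (mul_assoc e.1 f.1 g.1))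
    (fun e => Subtype.ext e.2)

/-! ### The free inverse monoid -/

/-- The free monoid on `X ∪ X⁻¹`; the letter `x` is `Sum.inl x` and the letter `x⁻¹` is
`Sum.inr x`. -/
abbrev InvWord (X : Type u) : Type u := FreeMonoid (X ⊕ X)

/-- The involution `(x₁ ⋯ xₙ)⁻¹ = xₙ⁻¹ ⋯ x₁⁻¹` on words. -/
def InvWord.inv {X : Type u} (w : InvWord X) : InvWord X :=
  FreeMonoid.ofList ((w.toList.map Sum.swap).reverse)

theorem InvWord.inv_mul {X : Type u} (u v : InvWord X) : (u * v).inv = v.inv * u.inv := by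
  simp [InvWord.inv, FreeMonoid.toList_mul, FreeMonoid.ofList_append]

theorem InvWord.inv_inv {X : Type u} (u : InvWord X) : u.inv.inv = u := by
  simp [InvWord.inv]

/-- The defining relations of the free inverse monoid. -/
inductive FIRel (X : Type u) : InvWord X → InvWord X → Prop
  | regular (u : InvWord X) : FIRel X (u * u.inv * u) u
  | comm (u v : InvWord X) : FIRel X (u * u.inv * (v * v.inv)) (v * v.inv * (u * u.inv))

/-- The free inverse monoid `FI(X)`. -/
def FI (X : Type u) : Type u := (conGen (FIRel X)).Quotient

instance FI.instMonoid (X : Type u) : Monoid (FI X) :=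
  inferInstanceAs (Monoid (conGen (FIRel X)).Quotient)

theorem FI.con_inv {X : Type u} {u v : InvWord X} (h : conGen (FIRel X) u v) :
    conGen (FIRel X) u.inv v.inv := by
  induction h with
  | of a b h =>
    refine ConGen.Rel.of _ _ ?_
    cases h with
    | regular =>
      have := FIRel.regular b.inv
      simpa only [InvWord.inv_mul, InvWord.inv_inv, mul_assoc] using this
    | comm u v =>
      have := FIRel.comm v u
      simpa only [InvWord.inv_mul, InvWord.inv_inv, mul_assoc] using this
  | refl a => exact ConGen.Rel.refl _
  | symm _ ih => exact ConGen.Rel.symm ih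
  | trans _ _ ih ih' => exact ConGen.Rel.trans ih ih'
  | mul _ _ ih ih' =>
    rw [InvWord.inv_mul, InvWord.inv_mul]
    exact ConGen.Rel.mul ih' ih

instance FI.instInverseMonoid (X : Type u) : InverseMonoid (FI X) where
  inv := Quotient.map InvWord.inv fun _ _ h => FI.con_inv h
  inv_inv' := by
    rintro ⟨x⟩; exact congrArg (Quotient.mk _) (InvWord.inv_inv x)
  mul_inv_rev' := by
    rintro ⟨x⟩ ⟨y⟩; exact congrArg (Quotient.mk _) (InvWord.inv_mul x y)
  mul_inv_mul_self := by
    rintro ⟨x⟩; exact Quotient.sound (ConGen.Rel.of _ _ (FIRel.regular x))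
  mul_inv_comm := by
    rintro ⟨x⟩ ⟨y⟩; exact Quotient.sound (ConGen.Rel.of _ _ (FIRel.comm x y))

/-- The value in `FI(X)` of a word over `X ∪ X⁻¹`. -/
def FI.mk {X : Type u} (w : InvWord X) : FI X := (conGen (FIRel X)).mk' w

/-- The assignment map `X → FI(X)`. -/
def FI.of {X : Type u} (x : X) : FI X := FI.mk (FreeMonoid.of (Sum.inl x))

/-! ### Presentations of inverse monoids -/

/-- The congruence on an inverse monoid generated by a relation. -/
inductive InvCongr {M : Type u} [InverseMonoid M] (R : M → M → Prop) : M → M → Prop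
  | of {a b} : R a b → InvCongr R a b
  | refl (a) : InvCongr R a a
  | symm {a b} : InvCongr R a b → InvCongr R b a
  | trans {a b c} : InvCongr R a b → InvCongr R b c → InvCongr R a c
  | mul {a b c d} : InvCongr R a b → InvCongr R c d → InvCongr R (a * c) (b * d)
  | inv {a b} : InvCongr R a b → InvCongr R a⁻¹ b⁻¹

def InvCongr.setoid {M : Type u} [InverseMonoid M] (R : M → M → Prop) : Setoid M where
  r := InvCongr R
  iseqv := ⟨.refl, .symm, .trans⟩

/-- `Inv⟨X | Q⟩`: the quotient of `FI(X)` by the congruence generated by `Q`. -/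
def InvPres {X : Type u} (Q : FI X → FI X → Prop) : Type u := Quotient (InvCongr.setoid Q)

instance InvPres.instInverseMonoid {X : Type u} (Q : FI X → FI X → Prop) :
    InverseMonoid (InvPres Q) where
  mul := Quotient.map₂ (· * ·) fun _ _ h _ _ h' => InvCongr.mul h h'
  one := Quotient.mk _ 1
  inv := Quotient.map (·⁻¹) fun _ _ h => InvCongr.inv h
  mul_assoc := by rintro ⟨x⟩ ⟨y⟩ ⟨z⟩; exact congrArg _ (mul_assoc x y z)
  one_mul := by rintro ⟨x⟩; exact congrArg _ (one_mul x)
  mul_one := by rintro ⟨x⟩; exact congrArg _ (mul_one x)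
  inv_inv' := by rintro ⟨x⟩; exact congrArg _ (InverseMonoid.inv_inv' x)
  mul_inv_rev' := by rintro ⟨x⟩ ⟨y⟩; exact congrArg _ (InverseMonoid.mul_inv_rev' x y)
  mul_inv_mul_self := by rintro ⟨x⟩; exact congrArg _ (InverseMonoid.mul_inv_mul_self x)
  mul_inv_comm := by rintro ⟨x⟩ ⟨y⟩; exact congrArg _ (InverseMonoid.mul_inv_comm x y)

/-- The canonical quotient map `FI(X) → Inv⟨X | Q⟩`. -/
def InvPres.mk {X : Type u} (Q : FI X → FI X → Prop) (a : FI X) : InvPres Q := Quotient.mk _ a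

/-! ### The universal inverse monoid and the maps `ψ` and `D` -/

/-- The `X`-canonical morphism `ψ : FBR(X) → FI(X)`. -/
def psiFree (X : Type u) : BRHom (FBR X) (FI X) := FBR.lift FI.of

/-- The relations `ψ(R)` on `FI(X)`. -/
def psiRel {X : Type u} (R : FBR X → FBR X → Prop) (a b : FI X) : Prop :=
  ∃ u v : FBR X, R u v ∧ (psiFree X).toFun u = a ∧ (psiFree X).toFun v = b

/-- The universal inverse monoid `Inv⟨X | ψ(R)⟩` of `BRestr⟨X | R⟩`. -/
abbrev UnivInv {X : Type u} (R : FBR X → FBR X → Prop) : Type u := InvPres (psiRel R)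

theorem psi_congr {X : Type u} (R : FBR X → FBR X → Prop) {a b : FBR X} (h : BRCongr R a b) :
    InvCongr (psiRel R) ((psiFree X).toFun a) ((psiFree X).toFun b) := by
  induction h with
  | of h => exact .of ⟨_, _, h, rfl, rfl⟩
  | refl => exact .refl _
  | symm _ ih => exact .symm ih
  | trans _ _ ih ih' => exact .trans ih ih'
  | mul _ _ ih ih' => rw [BRHom.map_mul, BRHom.map_mul]; exact .mul ih ih'
  | rstar _ ih => rw [BRHom.map_rstar, BRHom.map_rstar]; exact .mul (.inv ih) ih
  | rplus _ ih => rw [BRHom.map_rplus, BRHom.map_rplus]; exact .mul ih (.inv ih)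

/-- The `X`-canonical `(2,1,1,0)`-morphism from `BRestr⟨X | R⟩` to its universal inverse monoid. -/
def psi {X : Type u} (R : FBR X → FBR X → Prop) : BRHom (BRestr R) (UnivInv R) where
  toFun := Quotient.map (psiFree X).toFun fun _ _ h => psi_congr R h
  map_one := rfl
  map_mul := by
    rintro ⟨x⟩ ⟨y⟩; exact congrArg (InvPres.mk (psiRel R)) ((psiFree X).map_mul x y)
  map_rstar := by
    rintro ⟨x⟩; exact congrArg (InvPres.mk (psiRel R)) ((psiFree X).map_rstar x)
  map_rplus := by
    rintro ⟨x⟩; exact congrArg (InvPres.mk (psiRel R)) ((psiFree X).map_rplus x)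

theorem psi_of {X : Type u} (R : FBR X → FBR X → Prop) (x : X) :
    (psi R).toFun ((BRestr.mk R).toFun (FBR.of x)) = InvPres.mk (psiRel R) (FI.of x) := rfl

/-- One step of the recursion which defines `D`: from `D_u` and a letter `v ∈ X ∪ X⁻¹` it yields
`D_{uv}`, which is `(D_u x)^*` if `v = x` and `(x D_u)^+` if `v = x⁻¹`. -/
def DStep {X : Type u} (p : FBR X) : X ⊕ X → FBR X
  | .inl x => BirestrictionMonoid.rstar (p * FBR.of x)
  | .inr x => BirestrictionMonoid.rplus (FBR.of x * p)

/-- The element `D_w` of `FBR(X)` assigned to a word `w` over `X ∪ X⁻¹`: `D_1 = 1`,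
`D_{ux} = (D_u x)^*` and `D_{u x⁻¹} = (x D_u)^+`. -/
def DWord {X : Type u} (w : InvWord X) : FBR X := w.toList.foldl DStep 1

theorem DWord_one {X : Type u} : DWord (1 : InvWord X) = 1 := rfl

theorem DWord_mul_of {X : Type u} (w : InvWord X) (x : X) :
    DWord (w * FreeMonoid.of (Sum.inl x)) =
      BirestrictionMonoid.rstar (DWord w * FBR.of x) := by
  simp [DWord, DStep, FreeMonoid.toList_mul]

theorem DWord_mul_of_inv {X : Type u} (w : InvWord X) (x : X) :
    DWord (w * FreeMonoid.of (Sum.inr x)) =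
      BirestrictionMonoid.rplus (FBR.of x * DWord w) := by
  simp [DWord, DStep, FreeMonoid.toList_mul]

/-! Each `s` in `S` acts on the semilattice `P(S)` by `p ↦ (ps)^*` and `q ↦ (sq)^+`. These are
mutually inverse isomorphisms between the principal ideals generated by `s^+` and `s^*`, extended to
all of `P(S)` by meets. Such pairs form an inverse monoid, and `s ↦` its pair is a morphism of
birestriction monoids (`munnRep`), as in Munn's representation of inverse semigroups. It therefore
factors through `S̃`, so `S̃` acts on `P(S)`.

Let `D(m)` be the image of the top projection `1` under `m`. The letters `x` and `x⁻¹` act by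
precisely the two recursion steps for `D_w`, so `D_w` depends only on the value of `w` in `S̃`
(`UnivInv.toProj_mk`).

A projection `p` acts by meet with `p`, so `D(ψ(p)) = p`. Conversely, induction on words gives
`ψ(D_w) = w⁻¹w` (`psi_DWord`), hence `ψ(D(e)) = e` for an idempotent `e`. As `ψ` is multiplicative,
its inverse `D` on idempotents preserves meets. -/

/-! ### Arithmetic of projections -/

namespace BirestrictionMonoid

variable {S : Type u} [BirestrictionMonoid S]

/-- This congruence property of `*` makes `s ↦ (p ↦ (ps)^*)` turn products into composites; its dual
below does the same for `+`. -/
theorem rstar_mul_eq_rstar_rstar_mul (x y : S) : rstar (x * y) = rstar (rstar x * y) := by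
  rw [rstar_mul, rstar_mul_rstar, rstar_comm, ← rstar_mul_rstar, mul_assoc, mul_rstar_self]

theorem rplus_mul_eq_rplus_mul_rplus (x y : S) : rplus (x * y) = rplus (x * rplus y) := by
  rw [mul_rplus, rplus_rplus_mul, rplus_comm, ← rplus_rplus_mul, ← mul_assoc, rplus_mul_self]

theorem IsProjection.rstar_eq {e : S} (he : IsProjection e) : rstar e = e := by
  obtain ⟨x, rfl⟩ := he
  rw [← rplus_rstar x, rstar_rplus]

theorem IsProjection.rplus_eq {e : S} (he : IsProjection e) : rplus e = e := by
  obtain ⟨x, rfl⟩ := he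
  exact rplus_rstar x

/-- Since `e = e^*`, the axiom `rstar_mul` carries a projection across `s`; the dual below uses `e =
e^+`. -/
theorem IsProjection.mul_eq_mul_rstar {e : S} (he : IsProjection e) (s : S) :
    e * s = s * rstar (e * s) := by
  conv_lhs => rw [← he.rstar_eq, rstar_mul]

theorem IsProjection.mul_eq_rplus_mul {e : S} (he : IsProjection e) (s : S) :
    s * e = rplus (s * e) * s := by
  conv_lhs => rw [← he.rplus_eq, mul_rplus]

end BirestrictionMonoid

/-! ### The Munn monoid of a semilattice -/

/-- A pair of mutually inverse isomorphisms between two principal ideals of a semilattice with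
top, each extended to the whole semilattice by first meeting with the generator. -/
@[ext]
structure MunnMonoid (P : Type u) [SemilatticeInf P] [OrderTop P] where
  fwd : P → P
  bwd : P → P
  fwd_inf : ∀ p q, fwd (p ⊓ q) = fwd p ⊓ fwd q
  bwd_inf : ∀ p q, bwd (p ⊓ q) = bwd p ⊓ bwd q
  -- `bwd ⊤` generates the domain and `fwd ⊤` the range, so the round trips are meets with these
  -- generators.
  bwd_fwd : ∀ p, bwd (fwd p) = p ⊓ bwd ⊤
  fwd_bwd : ∀ p, fwd (bwd p) = p ⊓ fwd ⊤

namespace MunnMonoid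

variable {P : Type u} [SemilatticeInf P] [OrderTop P]

/-- Composition of partial isomorphisms, from left to right. -/
instance : Mul (MunnMonoid P) where
  mul a b :=
    { fwd := fun p => b.fwd (a.fwd p)
      bwd := fun p => a.bwd (b.bwd p)
      fwd_inf := fun p q => by rw [a.fwd_inf, b.fwd_inf]
      bwd_inf := fun p q => by rw [b.bwd_inf, a.bwd_inf]
      bwd_fwd := fun p => by
        rw [b.bwd_fwd, a.bwd_inf, a.bwd_fwd, inf_assoc, ← a.bwd_inf, top_inf_eq]
      fwd_bwd := fun p => by
        rw [a.fwd_bwd, b.fwd_inf, b.fwd_bwd, inf_assoc, ← b.fwd_inf, top_inf_eq] }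

instance : One (MunnMonoid P) where
  one :=
    { fwd := fun p => p
      bwd := fun p => p
      fwd_inf := fun _ _ => rfl
      bwd_inf := fun _ _ => rfl
      bwd_fwd := fun p => (inf_top_eq p).symm
      fwd_bwd := fun p => (inf_top_eq p).symm }

instance : Inv (MunnMonoid P) where
  inv a := ⟨a.bwd, a.fwd, a.bwd_inf, a.fwd_inf, a.fwd_bwd, a.bwd_fwd⟩

theorem fwd_mul (a b : MunnMonoid P) (p : P) : (a * b).fwd p = b.fwd (a.fwd p) := rfl

theorem bwd_mul (a b : MunnMonoid P) (p : P) : (a * b).bwd p = a.bwd (b.bwd p) := rfl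

theorem fwd_inv (a : MunnMonoid P) : a⁻¹.fwd = a.bwd := rfl

theorem bwd_inv (a : MunnMonoid P) : a⁻¹.bwd = a.fwd := rfl

/-- With total maps the product is plain composition, so the monoid laws are definitional. Both
components of `a * a⁻¹` are the meet with `a.bwd ⊤`, which is why such elements commute. -/
instance : InverseMonoid (MunnMonoid P) where
  mul_assoc _ _ _ := rfl
  one_mul _ := rfl
  mul_one _ := rfl
  inv_inv' _ := rfl
  mul_inv_rev' _ _ := rfl
  mul_inv_mul_self a := by
    ext p
    · simp only [fwd_mul, fwd_inv]
      rw [a.fwd_bwd, ← a.fwd_inf, inf_top_eq]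
    · simp only [bwd_mul, bwd_inv]
      rw [a.bwd_fwd, ← a.bwd_inf, inf_top_eq]
  mul_inv_comm a b := by
    ext p
    · simp only [fwd_mul, fwd_inv, a.bwd_fwd, b.bwd_fwd, inf_right_comm]
    · simp only [bwd_mul, bwd_inv, a.bwd_fwd, b.bwd_fwd, inf_right_comm]

end MunnMonoid

/-! ### The Munn representation of a birestriction monoid -/

open BirestrictionMonoid

instance Proj.instOrderTop (S : Type u) [BirestrictionMonoid S] : OrderTop (Proj S) where
  top := ⟨1, isProjection_one⟩
  le_top p := inf_eq_left.mp (Subtype.ext (mul_one p.1))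

theorem Proj.val_inf {S : Type u} [BirestrictionMonoid S] (p q : Proj S) :
    (p ⊓ q).1 = p.1 * q.1 := rfl

theorem Proj.val_top {S : Type u} [BirestrictionMonoid S] : (⊤ : Proj S).1 = 1 := rfl

/-- The element `s` acts on projections by `p ↦ (p s)^*`, with inverse `p ↦ (s p)^+`. -/
def munnFun {S : Type u} [BirestrictionMonoid S] (s : S) : MunnMonoid (Proj S) where
  fwd p := ⟨rstar (p.1 * s), isProjection_rstar _⟩
  bwd p := ⟨rplus (s * p.1), isProjection_rplus _⟩
  fwd_inf p q := Subtype.ext (by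
    change rstar (p.1 * q.1 * s) = rstar (p.1 * s) * rstar (q.1 * s)
    -- Replace `qs` by `s(qs)^*` and pull the projection out of the star. The first replacement also
    -- hits the right side; the last rewrite undoes it there.
    rw [mul_assoc, q.2.mul_eq_mul_rstar, ← mul_assoc, rstar_mul_rstar, ← q.2.mul_eq_mul_rstar])
  bwd_inf p q := Subtype.ext (by
    change rplus (s * (p.1 * q.1)) = rplus (s * p.1) * rplus (s * q.1)
    rw [← mul_assoc, p.2.mul_eq_rplus_mul, mul_assoc, rplus_rplus_mul, ← p.2.mul_eq_rplus_mul])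
  bwd_fwd p := Subtype.ext (by
    change rplus (s * rstar (p.1 * s)) = p.1 * rplus (s * 1)
    rw [mul_one, ← p.2.mul_eq_mul_rstar, ← p.2.rplus_eq, rplus_rplus_mul, p.2.rplus_eq])
  fwd_bwd p := Subtype.ext (by
    change rstar (rplus (s * p.1) * s) = p.1 * rstar (1 * s)
    rw [one_mul, ← p.2.mul_eq_rplus_mul, ← p.2.rstar_eq, rstar_mul_rstar, p.2.rstar_eq,
      (isProjection_rstar s).mul_comm p.2])

theorem munnFun_fwd_val {S : Type u} [BirestrictionMonoid S] (s : S) (p : Proj S) :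
    ((munnFun s).fwd p).1 = rstar (p.1 * s) := rfl

theorem munnFun_bwd_val {S : Type u} [BirestrictionMonoid S] (s : S) (p : Proj S) :
    ((munnFun s).bwd p).1 = rplus (s * p.1) := rfl

/-- A projection acts in both directions as the meet with itself, so comparing with such an action
settles `1`, `s^*` and `s^+` at once. -/
theorem munnFun_of_isProjection {S : Type u} [BirestrictionMonoid S] {e : S}
    (he : IsProjection e) (a : MunnMonoid (Proj S)) (hf : ∀ p, (a.fwd p).1 = p.1 * e)
    (hb : ∀ p, (a.bwd p).1 = p.1 * e) : munnFun e = a := by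
  ext p
  · refine Subtype.ext ?_
    rw [hf, munnFun_fwd_val, (p.2.mul he).rstar_eq]
  · refine Subtype.ext ?_
    rw [hb, munnFun_bwd_val, (he.mul p.2).rplus_eq, he.mul_comm p.2]

/-- The Munn representation of a birestriction monoid on its semilattice of projections. -/
def munnRep (S : Type u) [BirestrictionMonoid S] : BRHom S (MunnMonoid (Proj S)) where
  toFun := munnFun
  map_one := munnFun_of_isProjection isProjection_one 1 (fun p => (mul_one p.1).symm)
    (fun p => (mul_one p.1).symm)
  map_mul s t := by
    ext p
    · refine Subtype.ext ?_
      rw [MunnMonoid.fwd_mul]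
      simp only [munnFun_fwd_val]
      rw [← mul_assoc, rstar_mul_eq_rstar_rstar_mul]
    · refine Subtype.ext ?_
      rw [MunnMonoid.bwd_mul]
      simp only [munnFun_bwd_val]
      rw [mul_assoc, rplus_mul_eq_rplus_mul_rplus]
  map_rstar s := by
    -- Both components of `(munnFun s)⁻¹ * munnFun s` are this round trip, so one identity serves
    -- twice.
    have h (p : Proj S) : ((munnFun s).fwd ((munnFun s).bwd p)).1 = p.1 * rstar s := by
      rw [(munnFun s).fwd_bwd, Proj.val_inf, munnFun_fwd_val, Proj.val_top, one_mul]
    exact munnFun_of_isProjection (isProjection_rstar s) ((munnFun s)⁻¹ * munnFun s) h h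
  map_rplus s := by
    have h (p : Proj S) : ((munnFun s).bwd ((munnFun s).fwd p)).1 = p.1 * rplus s := by
      rw [(munnFun s).bwd_fwd, Proj.val_inf, munnFun_bwd_val, Proj.val_top, mul_one]
    exact munnFun_of_isProjection (isProjection_rplus s) (munnFun s * (munnFun s)⁻¹) h h

/-! ### Universal properties -/

/-- The evaluation of words over `X ∪ X⁻¹` in an inverse monoid. -/
def InvWord.eval {X : Type u} {M : Type v} [InverseMonoid M] (f : X → M) : InvWord X →* M :=
  FreeMonoid.lift (Sum.elim f fun x => (f x)⁻¹)

theorem InverseMonoid.inv_one {M : Type v} [InverseMonoid M] : (1 : M)⁻¹ = 1 :=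
  inv_eq_of_idem (mul_one 1)

theorem InvWord.eval_inv {X : Type u} {M : Type v} [InverseMonoid M] (f : X → M)
    (w : InvWord X) : InvWord.eval f w.inv = (InvWord.eval f w)⁻¹ := by
  induction w using FreeMonoid.inductionOn with
  | one =>
    change InvWord.eval f 1 = _
    rw [map_one, InverseMonoid.inv_one]
  | of x =>
    have h : InvWord.inv (FreeMonoid.of x) = FreeMonoid.of x.swap := rfl
    rw [h]
    rcases x with x | x
    · rfl
    · exact (InverseMonoid.inv_inv' (f x)).symm
  | mul u v hu hv =>
    rw [InvWord.inv_mul, map_mul, map_mul, hu, hv, InverseMonoid.mul_inv_rev']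

/-- The extension of a map `X → M` into an inverse monoid to `FI(X)`. -/
def FI.lift {X : Type u} {M : Type v} [InverseMonoid M] (f : X → M) : FI X →* M :=
  (conGen (FIRel X)).lift (InvWord.eval f) (Con.conGen_le.mpr fun u v h => by
    change InvWord.eval f u = InvWord.eval f v
    cases h with
    | regular =>
      simp only [map_mul, InvWord.eval_inv]
      exact InverseMonoid.mul_inv_mul_self _
    | comm =>
      simp only [map_mul, InvWord.eval_inv]
      exact InverseMonoid.mul_inv_comm _ _)

theorem FI.mk_surjective {X : Type u} : Function.Surjective (FI.mk (X := X)) :=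
  Con.mk'_surjective

theorem FI.mk_mul {X : Type u} (u v : InvWord X) : FI.mk (u * v) = FI.mk u * FI.mk v := rfl

theorem FI.mk_of_inv {X : Type u} (x : X) :
    FI.mk (FreeMonoid.of (Sum.inr x)) = (FI.of x)⁻¹ := rfl

theorem FI.lift_inv {X : Type u} {M : Type v} [InverseMonoid M] (f : X → M) (a : FI X) :
    FI.lift f a⁻¹ = (FI.lift f a)⁻¹ := by
  obtain ⟨w, rfl⟩ := FI.mk_surjective a
  exact InvWord.eval_inv f w

/-- Both sides are birestriction morphisms in `t` agreeing on generators, because `*` and `+` in `M`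
are `a⁻¹a` and `aa⁻¹`. This transfers relations in `R` to relations in `ψ(R)`. -/
theorem FI.lift_psiFree {X : Type u} {S : Type v} [BirestrictionMonoid S] {M : Type w}
    [InverseMonoid M] (φ : BRHom S M) (f : X → S) (t : FBR X) :
    FI.lift (fun x => φ.toFun (f x)) ((psiFree X).toFun t) =
      φ.toFun ((FBR.lift f).toFun t) := by
  obtain ⟨t⟩ := t
  change FI.lift _ (BRTerm.eval FI.of t) = φ.toFun (BRTerm.eval f t)
  induction t with
  | var x => rfl
  | one => exact (map_one _).trans φ.map_one.symm
  | mul s t hs ht => simp only [BRTerm.eval, map_mul, φ.map_mul, hs, ht]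
  | star s hs =>
    simp only [BRTerm.eval, φ.map_rstar, ← hs]
    exact (map_mul _ _ _).trans (by rw [FI.lift_inv]; rfl)
  | plus s hs =>
    simp only [BRTerm.eval, φ.map_rplus, ← hs]
    exact (map_mul _ _ _).trans (by rw [FI.lift_inv]; rfl)

theorem FBR.lift_mk {X : Type u} (R : FBR X → FBR X → Prop) (t : FBR X) :
    (FBR.lift fun x => (BRestr.mk R).toFun (FBR.of x)).toFun t = (BRestr.mk R).toFun t := by
  obtain ⟨t⟩ := t
  change BRTerm.eval _ t = (BRestr.mk R).toFun (Quotient.mk _ t)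
  induction t with
  | var x => rfl
  | one => rfl
  | mul s t hs ht => simp only [BRTerm.eval, hs, ht]; rfl
  | star s hs => simp only [BRTerm.eval, hs]; rfl
  | plus s hs => simp only [BRTerm.eval, hs]; rfl

theorem BRestr.mk_surjective {X : Type u} (R : FBR X → FBR X → Prop) :
    Function.Surjective (BRestr.mk R).toFun := Quotient.mk_surjective

theorem InvPres.mk_surjective {X : Type u} (Q : FI X → FI X → Prop) :
    Function.Surjective (InvPres.mk Q) := Quotient.mk_surjective

section UniversalInverseMonoid

variable {X : Type u} (R : FBR X → FBR X → Prop) {M : Type v} [InverseMonoid M]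

/-- A morphism from `BRestr⟨X | R⟩` to an inverse monoid factors through the universal inverse
monoid. -/
def UnivInv.lift (φ : BRHom (BRestr R) M) : UnivInv R → M :=
  Quotient.lift (FI.lift fun x => φ.toFun ((BRestr.mk R).toFun (FBR.of x))) fun a b h => by
    induction h with
    | of h =>
      -- The lift sends `ψ(u)` and `ψ(v)` to the `φ`-images of the classes of `u` and `v`, which
      -- coincide in `S`.
      obtain ⟨u, v, huv, rfl, rfl⟩ := h
      rw [FI.lift_psiFree, FI.lift_psiFree, FBR.lift_mk, FBR.lift_mk]
      exact congrArg φ.toFun (Quotient.sound (BRCongr.of huv))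
    | refl => rfl
    | symm _ ih => exact ih.symm
    | trans _ _ ih ih' => exact ih.trans ih'
    | mul _ _ ih ih' => rw [map_mul, map_mul, ih, ih']
    | inv _ ih => rw [FI.lift_inv, FI.lift_inv, ih]

theorem UnivInv.lift_mk (φ : BRHom (BRestr R) M) (w : InvWord X) :
    UnivInv.lift R φ (InvPres.mk (psiRel R) (FI.mk w)) =
      InvWord.eval (fun x => φ.toFun ((BRestr.mk R).toFun (FBR.of x))) w := rfl

theorem UnivInv.lift_psi (φ : BRHom (BRestr R) M) (s : BRestr R) :
    UnivInv.lift R φ ((psi R).toFun s) = φ.toFun s := by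
  obtain ⟨t, rfl⟩ := BRestr.mk_surjective R s
  change FI.lift _ ((psiFree X).toFun t) = _
  rw [FI.lift_psiFree, FBR.lift_mk]

/-! ### The maps `D` and `ψ` on projections and idempotents -/

/-- The map `D`: the greatest element of the range of the Munn representation. -/
def UnivInv.toProj (m : UnivInv R) : Proj (BRestr R) :=
  (UnivInv.lift R (munnRep (BRestr R)) m).fwd ⊤

/-- Induction on words which appends a letter on the right. -/
theorem InvWord.induction_append {p : InvWord X → Prop} (one : p 1)
    (inl : ∀ w x, p w → p (w * FreeMonoid.of (Sum.inl x)))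
    (inr : ∀ w x, p w → p (w * FreeMonoid.of (Sum.inr x))) (w : InvWord X) : p w := by
  suffices h : ∀ l : List (X ⊕ X), p (FreeMonoid.ofList l) from h w.toList
  intro l
  induction l using List.reverseRecOn with
  | nil => exact one
  | append_singleton l a ih =>
    rcases a with x | x
    · exact inl _ x ih
    · exact inr _ x ih

/-- Reading `w` from left to right, each letter's action is one step of the recursion, started at `⊤
= 1`. The left side sees only the value of `w`, which gives well-definedness. -/
theorem UnivInv.toProj_mk (w : InvWord X) :
    (UnivInv.toProj R (InvPres.mk (psiRel R) (FI.mk w))).1 =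
      (BRestr.mk R).toFun (DWord w) := by
  simp only [UnivInv.toProj, UnivInv.lift_mk]
  induction w using InvWord.induction_append with
  | one => rfl
  | inl w x ih =>
    rw [map_mul, MunnMonoid.fwd_mul, DWord_mul_of, BRHom.map_rstar, BRHom.map_mul, ← ih]
    rfl
  | inr w x ih =>
    rw [map_mul, MunnMonoid.fwd_mul, DWord_mul_of_inv, BRHom.map_rplus, BRHom.map_mul, ← ih]
    rfl

theorem UnivInv.toProj_psi (p : Proj (BRestr R)) :
    UnivInv.toProj R ((psi R).toFun p.1) = p := by
  refine Subtype.ext ?_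
  rw [UnivInv.toProj, UnivInv.lift_psi]
  change rstar (1 * p.1) = p.1
  rw [one_mul, p.2.rstar_eq]

theorem psi_DWord (w : InvWord X) :
    (psi R).toFun ((BRestr.mk R).toFun (DWord w)) =
      (InvPres.mk (psiRel R) (FI.mk w))⁻¹ * InvPres.mk (psiRel R) (FI.mk w) := by
  -- The identity already holds in `FI(X)`, before any relation is imposed.
  change InvPres.mk (psiRel R) ((psiFree X).toFun (DWord w)) =
    InvPres.mk (psiRel R) ((FI.mk w)⁻¹ * FI.mk w)
  congr 1
  induction w using InvWord.induction_append with
  | one => rfl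
  | inl w x ih =>
    rw [DWord_mul_of, BRHom.map_rstar, BRHom.map_mul, ih]
    change rstar (rstar (FI.mk w) * FI.of x) = rstar (FI.mk w * FI.of x)
    rw [← rstar_mul_eq_rstar_rstar_mul]
  | inr w x ih =>
    rw [DWord_mul_of_inv, BRHom.map_rplus, BRHom.map_mul, ih, FI.mk_mul, FI.mk_of_inv]
    change FI.of x * rstar (FI.mk w) * (FI.of x * rstar (FI.mk w))⁻¹ = _
    -- With `e = w⁻¹w` idempotent, `xe(xe)⁻¹ = xex⁻¹ = (wx⁻¹)⁻¹(wx⁻¹)`.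
    rw [InverseMonoid.mul_inv_rev', InverseMonoid.mul_inv_rev', InverseMonoid.inv_inv',
      InverseMonoid.inv_eq_of_idem (isProjection_rstar (FI.mk w)).mul_self,
      mul_assoc, ← mul_assoc (rstar (FI.mk w)), (isProjection_rstar (FI.mk w)).mul_self]
    change FI.of x * ((FI.mk w)⁻¹ * FI.mk w * (FI.of x)⁻¹) = _
    simp only [mul_assoc]

theorem psi_toProj (m : UnivInv R) :
    (psi R).toFun (UnivInv.toProj R m).1 = m⁻¹ * m := by
  obtain ⟨a, rfl⟩ := InvPres.mk_surjective _ m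
  obtain ⟨w, rfl⟩ := FI.mk_surjective a
  rw [UnivInv.toProj_mk, psi_DWord]

/-- The restriction of `ψ` to projections. -/
def psiProj : InfHom (Proj (BRestr R)) (Idem (UnivInv R)) where
  toFun p := ⟨(psi R).toFun p.1, by rw [← (psi R).map_mul, p.2.mul_self]⟩
  map_inf' p q := Subtype.ext ((psi R).map_mul p.1 q.1)

theorem toProj_psiProj (p : Proj (BRestr R)) : UnivInv.toProj R (psiProj R p).1 = p :=
  UnivInv.toProj_psi R p

theorem psiProj_toProj (e : Idem (UnivInv R)) : psiProj R (UnivInv.toProj R e.1) = e :=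
  Subtype.ext ((psi_toProj R e.1).trans (by rw [InverseMonoid.inv_eq_of_idem e.2, e.2]))

/-- The restriction of `D` to idempotents. -/
def idemToProj : InfHom (Idem (UnivInv R)) (Proj (BRestr R)) where
  toFun e := UnivInv.toProj R e.1
  map_inf' e f := by
    -- Meets are preserved because this map is inverse to the meet-preserving `psiProj`.
    rw [← toProj_psiProj R (UnivInv.toProj R e.1 ⊓ UnivInv.toProj R f.1), map_inf,
      psiProj_toProj, psiProj_toProj]

end UniversalInverseMonoid

theorem mainTheorem11 {X : Type u} (R : FBR X → FBR X → Prop) :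
    ∃ D : UnivInv R → Proj (BRestr R),
      (∀ w : InvWord X,
        (D (InvPres.mk (psiRel R) (FI.mk w))).1 = (BRestr.mk R).toFun (DWord w)) ∧
      ∃ (ψP : InfHom (Proj (BRestr R)) (Idem (UnivInv R)))
        (DE : InfHom (Idem (UnivInv R)) (Proj (BRestr R))),
        (∀ p : Proj (BRestr R), (ψP p).1 = (psi R).toFun p.1) ∧
        (∀ e : Idem (UnivInv R), DE e = D e.1) ∧
        Function.LeftInverse DE ψP ∧ Function.RightInverse DE ψP := by
  exact ⟨UnivInv.toProj R, UnivInv.toProj_mk R, psiProj R, idemToProj R, fun _ => rfl,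
    fun _ => rfl, toProj_psiProj R, psiProj_toProj R⟩
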